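/- **Theorem.** Let $K\ge 1$ and $0\le U\le D$ be integers with $U+D<K$. Consider the $(K,D,U)$ single unicast index coding problem with symmetric neighboring interference: there are $K$ messages $x_0,\dots,x_{K-1}$ and $K$ receivers; receiver $k$ wants $x_k$ and knows exactly the messages other than $x_k$ and its interference $x_{k-U},\dots,x_{k-1},x_{k+1},\dots,x_{k+D}$ (indices modulo $K$). Let $G$ be its side-information graph (there is an arc from $k$ to $j$ if and only if receiver $k$ knows $x_j$). An index code for $G$ over a message alphabet $\mathcal A$ is a map $\varepsilon:\mathcal A^K\to\mathcal A_P$ into some alphabet $\mathcal A_P$ such that each receiver $k$ can recover $x_k$ from $\varepsilon(x_0,\dots,x_{K-1})$ and the messages it knows. For $t\ge1$ let $\beta_t(G)$ be the minimum of $\lceil\log_2|\mathcal A_P|\rceil$ over all index codes (linear or not) with $|\mathcal A|=2^t$ and $\mathcal A_P$ finite, and let $\beta(G)=\inf_{t\ge1}\beta_t(G)/t$ be the broadcast rate. Let $\mathbf S'$ be the set of pairs of integers $(a,b)$, $a\ge0$, $b\ge1$, for which there is an integer $m'\ge1$ with $b(D+1)+a=m'K$ and $\gcd(bK,\,b(D+1)+a)=\gcd(b,m')K\ge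 b(U+1)$. This set is non-empty. Let $a_{\min}=\min\{a:(a,b)\in\mathbf S'\}$, let $b_{\min}$ be a number with $(a_{\min},b_{\min})\in\mathbf S'$, and put $R_{airm}(K,D,U)=D+1+\frac{a_{\min}}{b_{\min}}$. For $m,n\ge1$, the AIR matrix of size $m\times n$ is the $0/1$ matrix obtained as follows. Write $m=qn+r$ with $0\le r<n$ and fill the first $qn$ rows with $q$ copies of the identity matrix $I_n$ on top of each other; if $r>0$, write $n=q'r+r'$ with $0\le r'<r$ and fill the first $q'r$ columns of the remaining $r$ rows with $q'$ copies of $I_r$ side by side; if $r'>0$, fill the remaining $r\times r'$ block with the AIR matrix of size $r\times r'$. Then $R_{airm}(K,D,U)$ does not depend on the choice of $b_{\min}$, and $$\beta(G)\le R_{airm}(K,D,U).$$ Moreover, for every such $b_{\min}$ and every finite field $\mathbb F$, the rate $R_{airm}(K,D,U)$ is achieved by a $b_{\min}$-dimensional vector linear code over $\mathbb F$ whose encoding matrix is the AIR matrix $\mathbf L$ of size $Kb_{\min}\times(b_{\min}(D+1)+a_{\min})$: for messages $x_k\in\mathbb F^{b_{\min}}$, the map $(x_0,\dots,x_{K-1})\mapsto(x_0\,|\,x_1\,|\cdots|\,x_{K-1})\,\mathbf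 L$ is an index code for $G$, and the number of its code symbols per message symbol is $\frac{b_{\min}(D+1)+a_{\min}}{b_{\min}}=R_{airm}(K,D,U)$. -/

import Mathlib

namespace IndexCoding

/-- The map `enc` from message tuples (one message in `A` for every vertex) to broadcast words in
`P` is an index code for the side-information graph `G`: there is an arc `k → j` exactly when
receiver `k` knows message `j`, and receiver `k` recovers message `k` from the broadcast word and
the messages it knows. -/
def IsIndexCode {V A P : Type*} (G : Digraph V) (enc : (V → A) → P) : Prop :=
  ∀ k : V, ∃ dec : P → ({j : V // G.Adj k j} → A) → A,
    ∀ x : V → A, dec (enc x) (fun j => x j) = x k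

/-- `β_t(G)`: the minimum of `⌈log₂ |P|⌉` over all index codes for `G` (linear or not) with
messages of `t` bits and a finite transmission alphabet `P`. -/
noncomputable def broadcastLength {V : Type*} (G : Digraph V) (t : ℕ) : ℕ :=
  sInf {l : ℕ | ∃ (p : ℕ) (enc : (V → (Fin t → Bool)) → Fin p),
    IsIndexCode G enc ∧ l = Nat.clog 2 p}

/-- The broadcast rate `β(G) = inf_{t ≥ 1} β_t(G) / t`. -/
noncomputable def broadcastRate {V : Type*} (G : Digraph V) : ℝ :=
  ⨅ t : ℕ+, (broadcastLength G (t : ℕ) : ℝ) / ((t : ℕ) : ℝ)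

/-- The interference of receiver `k`: the `U` messages before and the `D` messages after
message `k`, indices modulo `K`. -/
def interference (K D U : ℕ) (k : Fin K) : Set (Fin K) :=
  {j | (∃ i : ℕ, 1 ≤ i ∧ i ≤ U ∧ ((j : ℕ) : ℤ) ≡ ((k : ℕ) : ℤ) - (i : ℤ) [ZMOD (K : ℤ)]) ∨
       (∃ i : ℕ, 1 ≤ i ∧ i ≤ D ∧ ((j : ℕ) : ℤ) ≡ ((k : ℕ) : ℤ) + (i : ℤ) [ZMOD (K : ℤ)])}

/-- The side-information graph of the `(K, D, U)` single unicast index coding problem with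
symmetric neighboring interference: receiver `k` knows every message except message `k` and the
messages in its interference. -/
def sniGraph (K D U : ℕ) : Digraph (Fin K) where
  Adj k j := j ≠ k ∧ j ∉ interference K D U k

/-- The entry in row `i` and column `j` (counted from `0`) of the `(m, n)` AIR matrix.
With `m = q n + r`, the first `q n` rows are filled with copies of `I_n` on top of each other;
with `n = q' r + r'`, the first `q' r` columns of the remaining `r` rows are filled with copies of
`I_r` next to each other; the remaining `r × r'` block is filled in the same way. The filling stops
as soon as no unfilled entry remains. -/
def airEntry (m n i j : ℕ) : ℕ :=
  if _h : n = 0 ∨ m % n = 0 then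
    if i % n = j then 1 else 0
  else if i < m - m % n then
    if i % n = j then 1 else 0
  else if j < n - n % (m % n) then
    if j % (m % n) = i - (m - m % n) then 1 else 0
  else
    airEntry (m % n) (n % (m % n)) (i - (m - m % n)) (j - (n - n % (m % n)))
termination_by n
decreasing_by
  have h1 : n ≠ 0 ∧ m % n ≠ 0 := by tauto
  exact (Nat.mod_lt _ (Nat.pos_of_ne_zero h1.2)).trans (Nat.mod_lt _ (Nat.pos_of_ne_zero h1.1))

/-- The AIR matrix of size `m × n` over `F`. -/
def airMatrix (F : Type*) [NatCast F] (m n : ℕ) : Matrix (Fin m) (Fin n) F :=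
  Matrix.of fun i j => ((airEntry m n i j : ℕ) : F)

/-- The `b`-dimensional vector linear encoding with encoding matrix `L` of size `K b × n`: the
messages `x_k ∈ F^b` are concatenated to a row vector, whose coordinate `k b + s` is the
`s`-th coordinate of `x_k`, and this row vector is multiplied by `L`. -/
def vectorLinearEncoding {F : Type*} [Semiring F] {K b n : ℕ}
    (L : Matrix (Fin (K * b)) (Fin n) F) (x : Fin K → (Fin b → F)) : Fin n → F :=
  Matrix.vecMul (fun r : Fin (K * b) => x r.divNat r.modNat) L

/-- The set `S'` of all pairs `(a, b)`, `a ≥ 0`, `b ≥ 1`, such that `b (D + 1) + a = m' K` for some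
`m' ≥ 1` with `gcd(b K, b (D + 1) + a) = gcd(b, m') K ≥ b (U + 1)`. -/
def admissiblePairs (K D U : ℕ) : Set (ℕ × ℕ) :=
  {p | 0 < p.2 ∧ ∃ m' : ℕ, 0 < m' ∧ p.2 * (D + 1) + p.1 = m' * K ∧
    Nat.gcd (p.2 * K) (p.2 * (D + 1) + p.1) = Nat.gcd p.2 m' * K ∧
    p.2 * (U + 1) ≤ Nat.gcd p.2 m' * K}

/-- `a_min`, the least `a` that occurs in a pair of `S'`. -/
noncomputable def aMin (K D U : ℕ) : ℕ :=
  sInf {a : ℕ | ∃ b : ℕ, (a, b) ∈ admissiblePairs K D U}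

/-- `b_min`, the value of `b` with `(a_min, b) ∈ S'`; it is unique if `a_min > 0`, and the least
such `b` is taken if `a_min = 0`. -/
noncomputable def bMin (K D U : ℕ) : ℕ :=
  sInf {b : ℕ | (aMin K D U, b) ∈ admissiblePairs K D U}

/-- `R_airm(K, D, U) = D + 1 + a_min / b_min`. -/
noncomputable def rAirm (K D U : ℕ) : ℝ :=
  (D : ℝ) + 1 + (aMin K D U : ℝ) / (bMin K D U : ℝ)

/-- The pair `(a_min, b_min)` exists. -/
theorem aMin_bMin_mem {K D U : ℕ} (hK : U + D < K) :
    (aMin K D U, bMin K D U) ∈ admissiblePairs K D U := by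
  have h0 : {a : ℕ | ∃ b : ℕ, (a, b) ∈ admissiblePairs K D U}.Nonempty := by
    refine ⟨K - (D + 1), 1, Nat.one_pos, 1, Nat.one_pos, ?_, ?_, ?_⟩
    · show 1 * (D + 1) + (K - (D + 1)) = 1 * K
      omega
    · show Nat.gcd (1 * K) (1 * (D + 1) + (K - (D + 1))) = Nat.gcd 1 1 * K
      have : 1 * (D + 1) + (K - (D + 1)) = K := by omega
      rw [this]; simp
    · show 1 * (U + 1) ≤ Nat.gcd 1 1 * K
      simp; omega
  have h1 : {b : ℕ | (aMin K D U, b) ∈ admissiblePairs K D U}.Nonempty := Nat.sInf_mem h0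
  exact Nat.sInf_mem h1

end IndexCoding

/-!
The AIR matrix follows the subtractive Euclidean algorithm: for `n ≤ m` it is `I_n` on top of the
`(m - n, n)` AIR matrix, and for `m < n` it is `I_m` next to the `(m, n - m)` AIR matrix
(`airEntry_of_le`, `airEntry_of_lt`). Two facts follow by induction along this algorithm.

* The word `(x L | x)` of length `n + m` vanishes only for `x = 0` as soon as it vanishes on `m`
  cyclically consecutive places (`eq_zero_of_airWord_window`). This form of the statement is stable
  under both steps of the algorithm, and it implies that any `n` cyclically consecutive rows of an
  AIR matrix with at least `n` rows are linearly independent (`eq_zero_of_airMul_eq_zero`).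
* The `(m N, n N)` AIR matrix is the Kronecker product of the `(m, n)` AIR matrix with `I_N`
  (`airEntry_mul`), so `x L = 0` decouples into one system for every residue class modulo `N`.

Let `b (D + 1) + a = m' K` and `N = gcd(b, m') K ≥ b (U + 1)`. Two message tuples that agree on what
receiver `k` knows differ by a vector supported on the rows of the messages `k - U, …, k + D`. Seen
from a row `i` of message `k`, these rows lie in the cyclic window from `i - (N - 1)` to
`i + (n - 1)`, where `n = m' K`. Those of them that are congruent to `i` modulo `N` are
`i, i + N, i + 2 N, …`, at most `n / N` cyclically consecutive rows of the reduced matrix. So if both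
tuples have the same encoding, they agree in row `i` (`airMul_decodable`). This applies to every
admissible pair; minimality of `a` enters only in the independence of the rate from `b`: if two
values of `b` occurred with the same minimal `a > 0`, their difference would be admissible with
`a = 0` (`eq_of_mem_admissiblePairs_aMin`). The bound for the broadcast rate is the case of the
field with two elements, with messages of `b` bits.
-/

namespace IndexCoding

open Finset

/-! ### The subtractive recursion of the AIR matrix -/

theorem airEntry_of_le {m n : ℕ} (hn : 0 < n) (hnm : n ≤ m) (i j : ℕ) (hi : i < m) :
    airEntry m n i j =
      if i < n then (if i = j then 1 else 0) else airEntry (m - n) n (i - n) j := by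
  have hmod : (m - n) % n = m % n := (Nat.mod_eq_sub_mod hnm).symm
  have hlt : m % n < n := Nat.mod_lt _ hn
  have hle : m % n ≤ m - n := by rw [← hmod]; exact Nat.mod_le _ _
  rw [airEntry.eq_1 m, airEntry.eq_1 (m - n), hmod]
  by_cases hin : i < n
  · have h1 : i < m - m % n := by omega
    simp [hin, h1, Nat.mod_eq_of_lt hin]
  · have h1 : (i - n) % n = i % n := (Nat.mod_eq_sub_mod (by omega)).symm
    have h2 : (i - n < m - n - m % n) ↔ (i < m - m % n) := by omega
    have h3 : i - n - (m - n - m % n) = i - (m - m % n) := by omega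
    simp [hin, h1, h2, h3]

theorem airEntry_of_lt {m n : ℕ} (hm : 0 < m) (hmn : m < n) (i j : ℕ) (hi : i < m) (hj : j < n) :
    airEntry m n i j =
      if j < m then (if i = j then 1 else 0) else airEntry m (n - m) i (j - m) := by
  have hmod : (n - m) % m = n % m := (Nat.mod_eq_sub_mod hmn.le).symm
  have hlt : n % m < m := Nat.mod_lt _ hm
  have hle : n % m ≤ n - m := by rw [← hmod]; exact Nat.mod_le _ _
  have hL : airEntry m n i j = if j < n - n % m then (if j % m = i then 1 else 0)
      else airEntry m (n % m) i (j - (n - n % m)) := by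
    rw [airEntry]
    have h0 : ¬ (n = 0 ∨ m % n = 0) := by rw [Nat.mod_eq_of_lt hmn]; omega
    simp [Nat.mod_eq_of_lt hmn, show n ≠ 0 by omega, hm.ne']
  rw [hL]
  by_cases hjm : j < m
  · have h1 : j < n - n % m := by omega
    simp [hjm, h1, Nat.mod_eq_of_lt hjm, eq_comm]
  rw [if_neg hjm]
  have h1 : (j - m) % m = j % m := (Nat.mod_eq_sub_mod (by omega)).symm
  rcases lt_trichotomy (n - m) m with h | h | h
  · have h2 : n % m = n - m := by rw [← hmod, Nat.mod_eq_of_lt h]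
    rw [if_neg (by omega), h2]
    congr 1
    omega
  · have h2 : n % m = 0 := by rw [← hmod, h, Nat.mod_self]
    rw [h2, Nat.sub_zero, if_pos hj, airEntry, h]
    have h3 : j % m = j - m := by rw [← h1, Nat.mod_eq_of_lt (by omega)]
    simp [Nat.mod_eq_of_lt hi, h3, eq_comm]
  · rw [airEntry.eq_1 m (n - m), Nat.mod_eq_of_lt h]
    have h2 : (j - m < n - m - n % m) ↔ (j < n - n % m) := by omega
    have h3 : j - m - (n - m - n % m) = j - (n - n % m) := by omega
    have h4 : ¬ (n - m = 0) := by omega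
    simp [hm.ne', h4, hmod, h1, h2, h3]

/-- The `(m N, n N)` AIR matrix is the Kronecker product of the `(m, n)` AIR matrix with `I_N`. -/
theorem airEntry_mul {N : ℕ} (m n i j : ℕ) (hi : i < m * N) (hj : j < n * N) :
    airEntry (m * N) (n * N) i j = if i % N = j % N then airEntry m n (i / N) (j / N) else 0 := by
  have hN : 0 < N := Nat.pos_of_ne_zero (by rintro rfl; simp at hi)
  have hm : 0 < m := Nat.pos_of_ne_zero (by rintro rfl; simp at hi)
  have hn : 0 < n := Nat.pos_of_ne_zero (by rintro rfl; simp at hj)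
  have hdiag : i = j ↔ i % N = j % N ∧ i / N = j / N := by
    refine ⟨fun h => by simp [h], fun h => ?_⟩
    rw [← Nat.div_add_mod i N, ← Nat.div_add_mod j N, h.1, h.2]
  have hid : i / N < m := Nat.div_lt_of_lt_mul (by rwa [mul_comm])
  have hjd : j / N < n := Nat.div_lt_of_lt_mul (by rwa [mul_comm])
  rcases le_or_gt n m with h | h
  · have hsub : m * N - n * N = (m - n) * N := (Nat.sub_mul _ _ _).symm
    rw [airEntry_of_le (Nat.mul_pos hn hN) (Nat.mul_le_mul_right N h) i j hi,
      airEntry_of_le hn h _ _ hid, hsub]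
    by_cases hin : i < n * N
    · have h1 : i / N < n := Nat.div_lt_of_lt_mul (by rwa [mul_comm])
      simp only [hin, h1, if_true, hdiag]
      split_ifs <;> simp_all
    · have h1 : ¬ i / N < n := by rw [Nat.div_lt_iff_lt_mul hN]; exact hin
      have hle : n * N ≤ i := not_lt.1 hin
      rw [if_neg hin, if_neg h1, airEntry_mul (m - n) n (i - n * N) j (by omega) hj,
        mul_comm n N, Nat.sub_mul_mod (by rwa [mul_comm]), Nat.sub_mul_div]
  · have hsub : n * N - m * N = (n - m) * N := (Nat.sub_mul _ _ _).symm
    rw [airEntry_of_lt (Nat.mul_pos hm hN) (Nat.mul_lt_mul_of_pos_right h hN) i j hi hj,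
      airEntry_of_lt hm h _ _ hid hjd, hsub]
    by_cases hjn : j < m * N
    · have h1 : j / N < m := Nat.div_lt_of_lt_mul (by rwa [mul_comm])
      simp only [hjn, h1, if_true, hdiag]
      split_ifs <;> simp_all
    · have h1 : ¬ j / N < m := by rw [Nat.div_lt_iff_lt_mul hN]; exact hjn
      have hle : m * N ≤ j := not_lt.1 hjn
      rw [if_neg hjn, if_neg h1, airEntry_mul m (n - m) i (j - m * N) hi (by omega),
        mul_comm m N, Nat.sub_mul_mod (by rwa [mul_comm]), Nat.sub_mul_div]
termination_by m + n

/-! ### Words of the AIR matrix and their zeros -/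

variable {F : Type*} [Ring F]

/-- The row vector `x L` for the `(m, n)` AIR matrix `L`. Vectors are encoded as functions on `ℕ` of
which only the first `m`, respectively `n`, values matter. -/
def airMul (m n : ℕ) (x : ℕ → F) (j : ℕ) : F :=
  ∑ i ∈ range m, x i * (airEntry m n i j : F)

/-- The word `(x L | x)` of length `n + m` for the `(m, n)` AIR matrix `L`. -/
def airWord (m n : ℕ) (x : ℕ → F) (p : ℕ) : F :=
  if p < n then airMul m n x p else x (p - n)

theorem airMul_eq_zero {m n : ℕ} {x : ℕ → F} (hx : ∀ i < m, x i = 0) (j : ℕ) :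
    airMul m n x j = 0 :=
  sum_eq_zero fun i hi => by rw [hx i (mem_range.1 hi), zero_mul]

theorem airMul_of_le {m n : ℕ} (hnm : n ≤ m) (x : ℕ → F) {j : ℕ} (hj : j < n) :
    airMul m n x j = x j + airMul (m - n) n (fun i => x (n + i)) j := by
  have hn : 0 < n := by omega
  obtain ⟨r, rfl⟩ := Nat.exists_eq_add_of_le hnm
  rw [airMul, airMul, sum_range_add, Nat.add_sub_cancel_left]
  congr 1
  · rw [sum_eq_single_of_mem j (mem_range.2 hj)]
    · rw [airEntry_of_le hn hnm _ _ (by omega)]; simp [hj]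
    · intro i hi hij
      rw [airEntry_of_le hn hnm _ _ (by have := mem_range.1 hi; omega)]
      simp [mem_range.1 hi, hij]
  · refine sum_congr rfl fun i hi => ?_
    rw [airEntry_of_le hn hnm _ _ (by have := mem_range.1 hi; omega)]
    simp

theorem airMul_of_lt_left {m n : ℕ} (hmn : m < n) (x : ℕ → F) {j : ℕ} (hj : j < m) :
    airMul m n x j = x j := by
  have hm : 0 < m := by omega
  rw [airMul, sum_eq_single_of_mem j (mem_range.2 hj)]
  · rw [airEntry_of_lt hm hmn _ _ hj (by omega)]; simp [hj]
  · intro i hi hij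
    rw [airEntry_of_lt hm hmn _ _ (mem_range.1 hi) (by omega)]
    simp [hj, hij]

theorem airMul_of_lt_right {m n : ℕ} (hmn : m < n) (x : ℕ → F) {j : ℕ} (hj : j < n - m) :
    airMul m n x (m + j) = airMul m (n - m) x j := by
  refine sum_congr rfl fun i hi => ?_
  have := mem_range.1 hi
  rw [airEntry_of_lt (by omega) hmn _ _ this (by omega)]
  simp

/-- The zeros of `(x L | x)` on `m` cyclically consecutive places force `x = 0`. The first
alternative of the hypothesis is a window without wrap-around, the second one consists of the first
`d` and the last `m - d` places. -/
theorem eq_zero_of_airWord_window (m n : ℕ) (x : ℕ → F)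
    (h : (∃ c ≤ n, ∀ p, c ≤ p → p < c + m → airWord m n x p = 0) ∨
      (∃ d ≤ m, (∀ p < d, airWord m n x p = 0) ∧
        ∀ p, n + d ≤ p → p < n + m → airWord m n x p = 0)) :
    ∀ i < m, x i = 0 := by
  rcases Nat.eq_zero_or_pos m with rfl | hm
  · intro i hi; omega
  rcases Nat.eq_zero_or_pos n with rfl | hn
  · intro i hi
    rcases h with ⟨c, hc, h⟩ | ⟨d, hd, h1, h2⟩
    · simpa [airWord] using h i (by omega) (by omega)
    · rcases lt_or_ge i d with hid | hid
      · simpa [airWord] using h1 i hid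
      · simpa [airWord] using h2 i (by omega) (by omega)
  -- the two parts `x L` and `x` of the word
  have hy : ∀ p < n, airWord m n x p = airMul m n x p := fun p hp => by simp [airWord, hp]
  have hx : ∀ i, airWord m n x (n + i) = x i := fun i => by simp [airWord]
  rcases le_or_gt n m with hnm | hnm
  · set x' : ℕ → F := fun i => x (n + i) with hx'
    have hrec : ∀ j < n, airMul m n x j = x j + airMul (m - n) n x' j :=
      fun j hj => airMul_of_le hnm x hj
    have hw : ∀ p < n, airWord (m - n) n x' p = airMul (m - n) n x' p :=
      fun p hp => by simp [airWord, hp]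
    have hw' : ∀ p, n ≤ p → airWord (m - n) n x' p = x p := fun p hp => by
      simp [airWord, not_lt.2 hp, hx', Nat.add_sub_cancel' hp]
    -- it suffices that the tail `x'` vanishes and that `x` or `x L` does at each early place
    have finish : (∀ i < m - n, x' i = 0) →
        (∀ j < n, x j = 0 ∨ airMul m n x j = 0) → ∀ i < m, x i = 0 := by
      intro ht hh i hi
      rcases lt_or_ge i n with hin | hin
      · rcases hh i hin with h0 | h0
        · exact h0
        · have := hrec i hin
          rw [h0, airMul_eq_zero ht, add_zero] at this
          exact this.symm
      · have := ht (i - n) (by omega)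
        simpa [hx', Nat.add_sub_cancel' hin] using this
    rcases h with ⟨c, hc, h⟩ | ⟨d, hd, h1, h2⟩
    · have hx0 : ∀ i, i + n < c + m → x i = 0 := fun i hi => by
        rw [← hx]; exact h _ (by omega) (by omega)
      have hy0 : ∀ j < n, c ≤ j → airMul m n x j = 0 := fun j hj hcj => by
        rw [← hy j hj]; exact h _ hcj (by omega)
      refine finish (eq_zero_of_airWord_window (m - n) n x' (Or.inl ⟨c, hc, ?_⟩)) ?_
      · intro p hcp hp
        rcases lt_or_ge p n with hpn | hpn
        · have := hrec p hpn
          rw [hy0 p hpn hcp, hx0 p (by omega), zero_add] at this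
          rw [hw p hpn, ← this]
        · rw [hw' p hpn, hx0 p (by omega)]
      · intro j hj
        rcases lt_or_ge j c with hjc | hjc
        · exact Or.inl (hx0 j (by omega))
        · exact Or.inr (hy0 j hj hjc)
    · have hx0 : ∀ i, d ≤ i → i < m → x i = 0 := fun i hi hi' => by
        rw [← hx]; exact h2 _ (by omega) (by omega)
      have hy0 : ∀ j < n, j < d → airMul m n x j = 0 := fun j hj hjd => by
        rw [← hy j hj]; exact h1 _ hjd
      rcases le_or_gt n d with hdn | hdn
      · have hx1 : ∀ i, n + i < d → x i = 0 := fun i hi => by rw [← hx]; exact h1 _ hi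
        have key : ∀ p < m, p + n < d ∨ d ≤ p → airWord (m - n) n x' p = 0 := by
          intro p hpm hp
          have hxp : x p = 0 := hp.elim (fun hp => hx1 p (by omega)) (fun hp => hx0 p hp hpm)
          rcases lt_or_ge p n with hpn | hpn
          · have := hrec p hpn
            rw [hy0 p hpn (by omega), hxp, zero_add] at this
            rw [hw p hpn, ← this]
          · rw [hw' p hpn, hxp]
        refine finish (eq_zero_of_airWord_window (m - n) n x' (Or.inr ⟨d - n, by omega, ?_, ?_⟩)) ?_
        · exact fun p hp => key p (by omega) (by omega)
        · exact fun p hp hp' => key p (by omega) (by omega)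
        · exact fun j hj => Or.inr (hy0 j hj (by omega))
      · refine finish (fun i hi => hx0 (n + i) (by omega) (by omega)) fun j hj => ?_
        rcases lt_or_ge j d with hjd | hjd
        · exact Or.inr (hy0 j hj hjd)
        · exact Or.inl (hx0 j hjd (by omega))
  · -- here the word is `(x | x L' | x)`, which is a cyclic extension of `(x L' | x)`
    have hfst : ∀ i < m, airWord m n x i = x i := fun i hi => by
      rw [hy i (by omega), airMul_of_lt_left hnm x hi]
    have hshift : ∀ p < n, airWord m (n - m) x p = airWord m n x (m + p) := by
      intro p hp
      rcases lt_or_ge p (n - m) with hpn | hpn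
      · rw [hy _ (by omega), airMul_of_lt_right hnm x hpn, airWord, if_pos hpn]
      · rw [airWord, if_neg (not_lt.2 hpn), ← hx]
        congr 1
        omega
    rcases h with ⟨c, hc, h⟩ | ⟨d, hd, h1, h2⟩
    · rcases le_or_gt m c with hmc | hmc
      · refine eq_zero_of_airWord_window m (n - m) x (Or.inl ⟨c - m, by omega, ?_⟩)
        intro p hp hp'
        rw [hshift p (by omega)]
        exact h _ (by omega) (by omega)
      · refine eq_zero_of_airWord_window m (n - m) x (Or.inr ⟨c, hmc.le, ?_, ?_⟩)
        · intro p hp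
          rw [hshift p (by omega)]
          exact h _ (by omega) (by omega)
        · intro p hp hp'
          rw [airWord, if_neg (by omega), ← hfst _ (by omega)]
          exact h _ (by omega) (by omega)
    · intro i hi
      rcases lt_or_ge i d with hid | hid
      · rw [← hfst i hi]; exact h1 i hid
      · rw [← hx]; exact h2 _ (by omega) (by omega)
termination_by m + n

/-- Any `n` cyclically consecutive rows of the `(m, n)` AIR matrix are linearly independent, `n ≤ m`;
here `x` is supported on such rows, and its zeros are described as in
`eq_zero_of_airWord_window`. -/
theorem eq_zero_of_airMul_eq_zero {m n : ℕ} (hnm : n ≤ m) {x : ℕ → F}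
    (hL : ∀ j < n, airMul m n x j = 0)
    (h : (∃ c ≤ n, ∀ p, c ≤ p → p < c + (m - n) → x p = 0) ∨
      (∃ d ≤ m - n, (∀ p < d, x p = 0) ∧ ∀ p, n + d ≤ p → p < m → x p = 0)) :
    ∀ i < m, x i = 0 := by
  -- up to the sign of its first `n` entries, `x` is itself a word of the `(m - n, n)` AIR matrix
  have hrec : ∀ j < n, airMul (m - n) n (fun i => x (n + i)) j = - x j := fun j hj => by
    have := airMul_of_le hnm x hj
    rw [hL j hj] at this
    exact eq_neg_of_add_eq_zero_right this.symm
  have hw : ∀ p, x p = 0 → airWord (m - n) n (fun i => x (n + i)) p = 0 := fun p hp => by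
    rcases lt_or_ge p n with hpn | hpn
    · rw [airWord, if_pos hpn, hrec p hpn, hp, neg_zero]
    · rw [airWord, if_neg (not_lt.2 hpn), Nat.add_sub_cancel' hpn, hp]
  have ht := eq_zero_of_airWord_window (m - n) n (fun i => x (n + i)) (by
    rcases h with ⟨c, hc, h⟩ | ⟨d, hd, h1, h2⟩
    · exact Or.inl ⟨c, hc, fun p hp hp' => hw p (h p hp hp')⟩
    · exact Or.inr ⟨d, hd, fun p hp => hw p (h1 p hp),
        fun p hp hp' => hw p (h2 p hp (by omega))⟩)
  intro i hi
  rcases lt_or_ge i n with hin | hin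
  · have := hrec i hin
    rw [airMul_eq_zero ht] at this
    exact neg_eq_zero.1 this.symm
  · have := ht (i - n) (by omega)
    simpa [Nat.add_sub_cancel' hin] using this

/-! ### Decoding a single symbol -/

theorem airMul_mul {N : ℕ} (m n : ℕ) (x : ℕ → F) {j s : ℕ} (hj : j < n) (hs : s < N) :
    airMul (m * N) (n * N) x (j * N + s) = airMul m n (fun i => x (i * N + s)) j := by
  have hjN : j * N + s < n * N := by nlinarith
  have hentry : ∀ i < m * N, airEntry (m * N) (n * N) i (j * N + s) =
      if i % N = s then airEntry m n (i / N) j else 0 := fun i hi => by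
    rw [airEntry_mul m n i _ hi hjN]
    simp [Nat.mod_eq_of_lt hs, Nat.add_div_of_dvd_right, Nat.div_eq_of_lt hs,
      Nat.mul_div_cancel _ (by omega : 0 < N)]
  rw [airMul, airMul]
  symm
  refine sum_of_injOn (fun i => i * N + s) ?_ ?_ ?_ ?_
  · intro i _ i' _ h
    exact Nat.eq_of_mul_eq_mul_right (by omega : 0 < N) (Nat.add_right_cancel h)
  · intro i hi
    have := mem_range.1 (mem_coe.1 hi)
    simp only [coe_range, Set.mem_Iio]
    nlinarith
  · intro i hi hi'
    rw [hentry i (mem_range.1 hi), if_neg, Nat.cast_zero, mul_zero]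
    rintro rfl
    refine hi' ⟨i / N, ?_, Nat.div_add_mod' i N⟩
    simpa using Nat.div_lt_of_lt_mul (by rw [mul_comm]; exact mem_range.1 hi)
  · intro i hi
    have := mem_range.1 hi
    rw [hentry _ (by nlinarith)]
    simp [Nat.mod_eq_of_lt hs, Nat.add_div_of_dvd_right, Nat.div_eq_of_lt hs,
      Nat.mul_div_cancel _ (by omega : 0 < N)]

/-- For the `(m N, n N)` AIR matrix, the symbol in row `i₀` is determined by the encoded word when
the unknown symbols lie in the cyclic window from `i₀ - (N - 1)` to `i₀ + (n N - 1)`. -/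
theorem airMul_decodable {N m n : ℕ} {x : ℕ → F}
    (hL : ∀ j < n * N, airMul (m * N) (n * N) x j = 0) {i₀ : ℕ} (hi₀ : i₀ < m * N)
    (hx : ∀ i < m * N, x i ≠ 0 →
      ∃ e : ℤ, -(N : ℤ) < e ∧ e < (n * N : ℕ) ∧ (i : ℤ) ≡ i₀ + e [ZMOD ((m * N : ℕ) : ℤ)]) :
    x i₀ = 0 := by
  have hN : 0 < N := Nat.pos_of_ne_zero (by rintro rfl; simp at hi₀)
  set s := i₀ % N with hs_def
  set q := i₀ / N with hq_def
  have hs : s < N := Nat.mod_lt _ hN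
  have hqs : q * N + s = i₀ := Nat.div_add_mod' i₀ N
  have hq : q < m := Nat.div_lt_of_lt_mul (by rwa [mul_comm])
  set y : ℕ → F := fun i => x (i * N + s) with hy
  have hyL : ∀ j < n, airMul m n y j = 0 := fun j hj => by
    rw [← airMul_mul m n x hj hs]
    exact hL _ (by nlinarith)
  -- within the residue class of `i₀`, the window starts at `i₀` because `e > -N`
  have hsupp : ∀ t < m, y t ≠ 0 → ∃ f k : ℤ, 0 ≤ f ∧ f < n ∧ (t : ℤ) = q + f + k * m := by
    intro t ht hyt
    obtain ⟨e, he, he', hmod⟩ := hx (t * N + s) (by nlinarith) hyt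
    obtain ⟨k, hk⟩ := hmod.symm.dvd
    have hN' : (0 : ℤ) < N := by exact_mod_cast hN
    have he_eq : e = N * (t - q - k * m) := by
      rw [← hqs] at hk
      push_cast at hk
      linarith
    refine ⟨t - q - k * m, k, ?_, ?_, by ring⟩
    · by_contra hneg
      have : (t - q - k * m : ℤ) ≤ -1 := by omega
      nlinarith
    · rw [he_eq] at he'
      push_cast at he'
      by_contra hge
      have : (n : ℤ) ≤ t - q - k * m := not_lt.1 hge
      nlinarith
  suffices h : ∀ i < m, y i = 0 by
    have := h q hq
    simpa [hy, hqs] using this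
  rcases le_or_gt n m with hnm | hnm
  · refine eq_zero_of_airMul_eq_zero hnm hyL ?_
    rcases le_or_gt (q + n) m with hqn | hqn
    · have key : ∀ t < m, t < q ∨ n + q ≤ t → y t = 0 := by
        intro t ht htq
        by_contra hne
        obtain ⟨f, k, hf, hf', hk⟩ := hsupp t ht hne
        have h1 : k < 1 := by by_contra hc; nlinarith [not_lt.1 hc]
        have h2 : -1 < k := by by_contra hc; nlinarith [not_lt.1 hc]
        obtain rfl : k = 0 := by omega
        omega
      exact Or.inr ⟨q, by omega, fun p hp => key p (by omega) (by omega),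
        fun p hp hp' => key p hp' (by omega)⟩
    · refine Or.inl ⟨q + n - m, by omega, fun t ht ht' => ?_⟩
      by_contra hne
      obtain ⟨f, k, hf, hf', hk⟩ := hsupp t (by omega) hne
      have htq : t < q := by omega
      have h1 : k < 1 := by by_contra hc; nlinarith [not_lt.1 hc]
      have h2 : -2 < k := by by_contra hc; nlinarith [not_lt.1 hc]
      obtain rfl | rfl : k = 0 ∨ k = -1 := by omega
      · omega
      · omega
  · -- a matrix with fewer rows than columns has independent rows altogether
    refine eq_zero_of_airWord_window m n y (Or.inl ⟨0, by omega, fun p _ hp => ?_⟩)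
    rw [airWord, if_pos (by omega)]
    exact hyL p (by omega)

/-! ### The vector linear code -/

/-- A code is an index code as soon as two message tuples with the same encoding that agree on what
a receiver knows also agree on what it wants. -/
theorem isIndexCode_of_injective {V A P : Type*} [Nonempty A] {G : Digraph V} {enc : (V → A) → P}
    (h : ∀ k, ∀ x x' : V → A, enc x = enc x' → (∀ j, G.Adj k j → x j = x' j) → x k = x' k) :
    IsIndexCode G enc := by
  classical
  intro k
  refine ⟨fun p s => if hp : ∃ x, enc x = p ∧ (fun j : {j // G.Adj k j} => x j) = s
    then hp.choose k else Classical.arbitrary A, fun x => ?_⟩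
  have hp : ∃ x', enc x' = enc x ∧
      (fun j : {j // G.Adj k j} => x' j) = fun j : {j // G.Adj k j} => x j := ⟨x, rfl, rfl⟩
  simp only [dif_pos hp]
  exact h k _ _ hp.choose_spec.1 fun j hj => congrFun hp.choose_spec.2 ⟨j, hj⟩

/-- The messages unknown to receiver `k` are at cyclic distance between `-U` and `D` from `k`. -/
theorem exists_offset_of_not_adj {K D U : ℕ} {k j : Fin K} (h : ¬ (sniGraph K D U).Adj k j) :
    ∃ e : ℤ, -(U : ℤ) ≤ e ∧ e ≤ D ∧ ((j : ℕ) : ℤ) ≡ ((k : ℕ) : ℤ) + e [ZMOD (K : ℤ)] := by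
  by_cases hjk : j = k
  · exact ⟨0, by omega, by omega, by simp [hjk]⟩
  have h' : j ∈ interference K D U k := by
    by_contra hni
    exact h ⟨hjk, hni⟩
  rcases h' with ⟨i, h1, h2, h3⟩ | ⟨i, h1, h2, h3⟩
  · exact ⟨-i, by omega, by omega, by rwa [← sub_eq_add_neg]⟩
  · exact ⟨i, by omega, by omega, h3⟩

theorem isIndexCode_airMatrix (F : Type*) [Ring F] {K D U a b : ℕ}
    (hab : (a, b) ∈ admissiblePairs K D U) :
    IsIndexCode (sniGraph K D U)
      (vectorLinearEncoding (airMatrix F (K * b) (b * (D + 1) + a))) := by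
  obtain ⟨hb, m', hm', hn, -, hU⟩ := hab
  dsimp only at hb hn hU
  set g := Nat.gcd b m' with hg
  obtain ⟨β, hβ⟩ : g ∣ b := Nat.gcd_dvd_left _ _
  obtain ⟨μ, hμ⟩ : g ∣ m' := Nat.gcd_dvd_right _ _
  have hrows : K * b = β * (g * K) := by nth_rewrite 1 [hβ]; ring
  have hcols : b * (D + 1) + a = μ * (g * K) := by rw [hn]; nth_rewrite 1 [hμ]; ring
  refine isIndexCode_of_injective fun k x x' henc hknown => ?_
  let d : ℕ → F := fun i => if h : i < K * b then
    x (Fin.divNat ⟨i, h⟩) (Fin.modNat ⟨i, h⟩) - x' (Fin.divNat ⟨i, h⟩) (Fin.modNat ⟨i, h⟩) else 0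
  have hd : ∀ j < b * (D + 1) + a, airMul (K * b) (b * (D + 1) + a) d j = 0 := by
    intro j hj
    have h1 := congrFun henc ⟨j, hj⟩
    simp only [vectorLinearEncoding, Matrix.vecMul, dotProduct, airMatrix, Matrix.of_apply] at h1
    rw [airMul, ← Fin.sum_univ_eq_sum_range
      (fun i => d i * (airEntry (K * b) (b * (D + 1) + a) i j : F)), ← sub_eq_zero.2 h1,
      ← sum_sub_distrib]
    refine sum_congr rfl fun i _ => ?_
    simp [d, sub_mul]
  ext s
  have hlt : (k : ℕ) * b + s < K * b := by
    have := k.2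
    have := s.2
    nlinarith
  have hdiv : ((k : ℕ) * b + s) / b = k := by
    rw [mul_comm, Nat.mul_add_div hb, Nat.div_eq_of_lt s.2, add_zero]
  have hmod : ((k : ℕ) * b + s) % b = s := by
    rw [mul_comm, Nat.mul_add_mod, Nat.mod_eq_of_lt s.2]
  have hd0 : d (k * b + s) = x k s - x' k s := by
    have e1 : Fin.divNat (⟨k * b + s, hlt⟩ : Fin (K * b)) = k := Fin.ext hdiv
    have e2 : Fin.modNat (⟨k * b + s, hlt⟩ : Fin (K * b)) = s := Fin.ext hmod
    simp only [d, dif_pos hlt, e1, e2]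
  rw [← sub_eq_zero, ← hd0]
  rw [hrows] at hlt
  rw [hrows, hcols] at hd
  refine airMul_decodable hd hlt fun i hi hne => ?_
  rw [← hrows] at hi ⊢
  rw [← hcols]
  have hnadj : ¬ (sniGraph K D U).Adj k (Fin.divNat ⟨i, hi⟩) := fun hadj => hne (by
    simp [d, hi, hknown _ hadj])
  obtain ⟨e, he, he', hcong⟩ := exists_offset_of_not_adj hnadj
  have hcong' : ((i / b : ℕ) : ℤ) ≡ (k : ℕ) + e [ZMOD (K : ℤ)] := hcong
  obtain ⟨t, ht⟩ := hcong'.dvd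
  have hi_eq : ((i / b : ℕ) : ℤ) * b + (i % b : ℕ) = i := by exact_mod_cast Nat.div_add_mod' i b
  have hib : ((i % b : ℕ) : ℤ) < b := by exact_mod_cast Nat.mod_lt i hb
  have hib' : (0 : ℤ) ≤ ((i % b : ℕ) : ℤ) := Int.natCast_nonneg _
  have hsb : ((s : ℕ) : ℤ) < b := by exact_mod_cast s.2
  have hsb' : (0 : ℤ) ≤ ((s : ℕ) : ℤ) := Int.natCast_nonneg _
  have hU' : (b : ℤ) * (U + 1) ≤ (g * K : ℕ) := by exact_mod_cast hU
  have hb' : (0 : ℤ) < b := by exact_mod_cast hb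
  refine ⟨e * b + (i % b : ℕ) - (s : ℕ), ?_, ?_, ?_⟩
  · nlinarith
  · push_cast
    push_cast at hib hsb
    nlinarith
  · refine (Int.modEq_iff_dvd).2 ⟨t, ?_⟩
    rw [← hi_eq]
    push_cast
    push_cast at ht
    linear_combination (b : ℤ) * ht

/-! ### The rate -/

theorem mem_admissiblePairs_iff {K D U a b : ℕ} :
    (a, b) ∈ admissiblePairs K D U ↔
      0 < b ∧ ∃ m' : ℕ, 0 < m' ∧ b * (D + 1) + a = m' * K ∧ b * (U + 1) ≤ Nat.gcd b m' * K := by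
  constructor
  · rintro ⟨hb, m', hm', h1, -, h2⟩
    exact ⟨hb, m', hm', h1, h2⟩
  · rintro ⟨hb, m', hm', h1, h2⟩
    refine ⟨hb, m', hm', h1, ?_, h2⟩
    change Nat.gcd (b * K) (b * (D + 1) + a) = _
    rw [h1, Nat.gcd_mul_right]

theorem aMin_le {K D U a b : ℕ} (h : (a, b) ∈ admissiblePairs K D U) : aMin K D U ≤ a :=
  Nat.sInf_le ⟨b, h⟩

/-- In a pair with the minimal `a > 0`, the integers `b` and `m'` are coprime, since otherwise their
common divisor could be divided out; so the condition on `b` becomes `b (U + 1) ≤ K`. -/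
theorem exists_of_mem_admissiblePairs_aMin {K D U b : ℕ} (ha : 0 < aMin K D U)
    (h : (aMin K D U, b) ∈ admissiblePairs K D U) :
    ∃ m' : ℕ, b * (D + 1) + aMin K D U = m' * K ∧ b * (U + 1) ≤ K := by
  obtain ⟨hb, m', hm', h1, h2⟩ := mem_admissiblePairs_iff.1 h
  refine ⟨m', h1, ?_⟩
  obtain ⟨g, β, μ, hg, hcop, hβ, hμ⟩ := Nat.exists_coprime' (Nat.gcd_pos_of_pos_left m' hb)
  have hgcd : Nat.gcd b m' = g := by
    rw [hβ, hμ, Nat.gcd_mul_right, hcop.gcd_eq_one, one_mul]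
  rw [hgcd] at h2
  have hβK : β * (U + 1) ≤ K := by
    refine Nat.le_of_mul_le_mul_left ?_ hg
    calc g * (β * (U + 1)) = b * (U + 1) := by rw [hβ]; ring
      _ ≤ g * K := h2
  have hβ0 : 0 < β := Nat.pos_of_ne_zero (by rintro rfl; simp at hβ; omega)
  have hμ0 : 0 < μ := Nat.pos_of_ne_zero (by rintro rfl; simp at hμ; omega)
  have hle : β * (D + 1) ≤ μ * K := by
    refine Nat.le_of_mul_le_mul_left ?_ hg
    calc g * (β * (D + 1)) = b * (D + 1) := by rw [hβ]; ring
      _ ≤ m' * K := by omega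
      _ = g * (μ * K) := by rw [hμ]; ring
  obtain ⟨a', ha'⟩ := Nat.exists_eq_add_of_le hle
  have hadm : (a', β) ∈ admissiblePairs K D U := mem_admissiblePairs_iff.2
    ⟨hβ0, μ, hμ0, ha'.symm, by rw [hcop.gcd_eq_one, one_mul]; exact hβK⟩
  have hmin := aMin_le hadm
  have haa : aMin K D U = g * a' := by
    have : b * (D + 1) + aMin K D U = b * (D + 1) + g * a' := by
      rw [h1, hμ, hβ]
      linear_combination (g : ℕ) * ha'
    omega
  have hg1 : g = 1 := by
    by_contra hne
    have : 2 ≤ g := by omega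
    nlinarith
  rw [hβ, hg1, mul_one]
  exact hβK

theorem eq_of_mem_admissiblePairs_aMin {K D U b b' : ℕ} (ha : 0 < aMin K D U)
    (h : (aMin K D U, b) ∈ admissiblePairs K D U) (h' : (aMin K D U, b') ∈ admissiblePairs K D U) :
    b = b' := by
  wlog hlt : b < b' generalizing b b'
  · rcases (not_lt.1 hlt).eq_or_lt with heq | hlt'
    · exact heq.symm
    · exact (this h' h hlt').symm
  exfalso
  obtain ⟨m₁, h1, -⟩ := exists_of_mem_admissiblePairs_aMin ha h
  obtain ⟨m₂, h2, hle⟩ := exists_of_mem_admissiblePairs_aMin ha h'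
  obtain ⟨δ, rfl⟩ := Nat.exists_eq_add_of_lt hlt
  have hmm : m₁ < m₂ := by
    refine Nat.lt_of_mul_lt_mul_right (a := K) ?_
    rw [← h1, ← h2]
    nlinarith
  obtain ⟨ε, rfl⟩ := Nat.exists_eq_add_of_lt hmm
  have hadm : (0, δ + 1) ∈ admissiblePairs K D U := by
    refine mem_admissiblePairs_iff.2 ⟨by omega, ε + 1, by omega, by linarith, ?_⟩
    have hg : 1 ≤ Nat.gcd (δ + 1) (ε + 1) := Nat.gcd_pos_of_pos_left _ (by omega)
    nlinarith
  have := aMin_le hadm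
  omega

theorem rate_eq_rAirm {K D U b : ℕ} (hK : U + D < K)
    (h : (aMin K D U, b) ∈ admissiblePairs K D U) :
    ((b * (D + 1) + aMin K D U : ℕ) : ℝ) / (b : ℝ) = rAirm K D U := by
  have hb : (b : ℝ) ≠ 0 := by exact_mod_cast (h.1 : 0 < b).ne'
  have hR : (aMin K D U : ℝ) / (bMin K D U : ℝ) = (aMin K D U : ℝ) / (b : ℝ) := by
    rcases Nat.eq_zero_or_pos (aMin K D U) with h0 | h0
    · simp [h0]
    · rw [eq_of_mem_admissiblePairs_aMin h0 (aMin_bMin_mem hK) h]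
  rw [rAirm, hR]
  push_cast
  field_simp

theorem IsIndexCode.comp_equiv {V A B P Q : Type*} {G : Digraph V} {enc : (V → A) → P}
    (h : IsIndexCode G enc) (e : B ≃ A) (f : P ≃ Q) :
    IsIndexCode G (fun x : V → B => f (enc fun v => e (x v))) := by
  intro k
  obtain ⟨dec, hdec⟩ := h k
  exact ⟨fun p s => e.symm (dec (f.symm p) fun j => e (s j)), fun x => by
    simp [hdec fun v => e (x v)]⟩

theorem broadcastRate_le {V : Type*} {G : Digraph V} {b n : ℕ} (hb : 0 < b)
    {enc : (V → (Fin b → ZMod 2)) → (Fin n → ZMod 2)} (h : IsIndexCode G enc) :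
    broadcastRate G ≤ (n : ℝ) / b := by
  have hlen : broadcastLength G b ≤ n := by
    refine Nat.sInf_le ⟨2 ^ n, _, h.comp_equiv
      (Equiv.arrowCongr (Equiv.refl (Fin b)) finTwoEquiv.symm)
      (Fintype.equivFinOfCardEq (by rw [Fintype.card_fun, ZMod.card, Fintype.card_fin])), ?_⟩
    exact (Nat.clog_pow 2 n (by norm_num)).symm
  have hbdd : BddBelow (Set.range fun t : ℕ+ =>
      (broadcastLength G (t : ℕ) : ℝ) / ((t : ℕ) : ℝ)) :=
    ⟨0, by rintro _ ⟨t, rfl⟩; positivity⟩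
  refine (ciInf_le hbdd ⟨b, hb⟩).trans ?_
  change (broadcastLength G b : ℝ) / (b : ℝ) ≤ n / b
  gcongr

end IndexCoding

theorem mainTheorem1 (K D U : ℕ) (hUD : U ≤ D) (hK : U + D < K) :
    IndexCoding.broadcastRate (IndexCoding.sniGraph K D U) ≤ IndexCoding.rAirm K D U ∧
    ∀ b : ℕ, (IndexCoding.aMin K D U, b) ∈ IndexCoding.admissiblePairs K D U →
      ((b * (D + 1) + IndexCoding.aMin K D U : ℕ) : ℝ) / (b : ℝ) = IndexCoding.rAirm K D U ∧
      ∀ (F : Type*) [Field F] [Finite F],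
        IndexCoding.IsIndexCode (IndexCoding.sniGraph K D U)
          (IndexCoding.vectorLinearEncoding
            (IndexCoding.airMatrix F (K * b) (b * (D + 1) + IndexCoding.aMin K D U))) := by
  refine ⟨?_, fun b hb => ⟨IndexCoding.rate_eq_rAirm hK hb,
    fun F _ _ => IndexCoding.isIndexCode_airMatrix F hb⟩⟩
  have hmem := IndexCoding.aMin_bMin_mem hK
  rw [← IndexCoding.rate_eq_rAirm hK hmem]
  exact IndexCoding.broadcastRate_le hmem.1
    (IndexCoding.isIndexCode_airMatrix (ZMod 2) hmem)
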